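/- Let $T$ be the rooted ordered tree whose root $u_1$ has four children, from left to right a leaf, a leaf, a node $u_2$ and a leaf; where the children of $u_2$ are, from left to right, a leaf, a leaf and a node $u_3$; and where $u_3$ has two children, both leaves. Let $T'$ be the tree obtained from $T$ by adding one further leaf as the last (rightmost) child of $u_2$. Both trees are quaternary (every node has at most 4 children). A poly-line drawing represents nodes by points in the plane and edges by poly-lines joining their ends, where all nodes and bends have integral $x$-coordinates; it is a straight-line drawing if no edge has a bend. Its width is the smallest $W$ such that, after a translation, all these $x$-coordinates lie between $1$ and $W$. It is planar if nodes are distinct points, edges are simple curves that contain no nodes other than their ends, and distinct edges meet only in common ends; it is strictly-upward if each edge is strictly $y$-monotone, descending from the parent to the child; and it is order-preserving if at each node the edges to the children leave from left to right in the given order of the children. An ideal drawing is a planar, strictly-upward, order-preserving straight-line drawing. Then each of $T$ and $T'$ has a planar strictly-upward order-preserving poly-line drawing of width $2$, but neither has an ideal drawing of width $2$. -/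

import Mathlib

namespace TreeDrawing

/-- A rooted ordered tree on the node set `V`: `children u` lists the children of `u` from left
to right. -/
structure OrderedTree (V : Type) where
  root : V
  children : V → List V
  nodup_children : ∀ u, (children u).Nodup
  root_not_child : ∀ u, root ∉ children u
  parent_unique : ∀ u u' v, v ∈ children u → v ∈ children u' → u = u'
  reachable : ∀ v, Relation.ReflTransGen (fun u w => w ∈ children u) root v

/-- An edge is a node together with the index of one of its children. -/
abbrev OrderedTree.Edge {V : Type} (T : OrderedTree V) : Type :=
  Σ u : V, Fin (T.children u).length

def OrderedTree.Edge.parent {V : Type} {T : OrderedTree V} (e : T.Edge) : V := e.1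

def OrderedTree.Edge.child {V : Type} {T : OrderedTree V} (e : T.Edge) : V :=
  (T.children e.1).get e.2

/-- A point of the plane with integral `x`-coordinate. -/
abbrev GridPoint : Type := ℤ × ℝ

def GridPoint.toPlane (p : GridPoint) : ℝ × ℝ := ((p.1 : ℝ), p.2)

/-- The set of points of the plane covered by the poly-line with the given vertices. -/
def trace : List GridPoint → Set (ℝ × ℝ)
  | [] => ∅
  | [p] => {p.toPlane}
  | p :: q :: l => segment ℝ p.toPlane q.toPlane ∪ trace (q :: l)

/-- A poly-line does not touch itself: its vertices are distinct, and the parts before and after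
any vertex meet only in that vertex. -/
def IsSimplePolyline (l : List GridPoint) : Prop :=
  l.Nodup ∧ ∀ (a b : List GridPoint) (p : GridPoint), l = a ++ p :: b →
    trace (a ++ [p]) ∩ trace (p :: b) ⊆ {p.toPlane}

/-- A poly-line drawing: nodes are points, and each edge has a list of bends, given in the order
from the parent to the child. Nodes and bends have integral `x`-coordinates. -/
structure PolylineDrawing {V : Type} (T : OrderedTree V) where
  pos : V → GridPoint
  bends : T.Edge → List GridPoint

namespace PolylineDrawing

variable {V : Type} {T : OrderedTree V}

/-- The vertices of the poly-line of an edge, from the parent to the child. -/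
def path (D : PolylineDrawing T) (e : T.Edge) : List GridPoint :=
  D.pos e.parent :: (D.bends e ++ [D.pos e.child])

/-- The endpoint of the first segment of an edge, seen from the parent. -/
def firstStep (D : PolylineDrawing T) (e : T.Edge) : GridPoint :=
  (D.bends e).headD (D.pos e.child)

/-- Planarity: distinct nodes are distinct points, edges are simple curves, an edge contains no
node other than its ends, and distinct edges meet only in common ends. -/
def IsPlanar (D : PolylineDrawing T) : Prop :=
  Function.Injective D.pos ∧
  (∀ e, IsSimplePolyline (D.path e)) ∧
  (∀ e w, (D.pos w).toPlane ∈ trace (D.path e) → w = e.parent ∨ w = e.child) ∧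
  (∀ e f : T.Edge, e ≠ f → ∀ p ∈ trace (D.path e) ∩ trace (D.path f),
    ∃ w, p = (D.pos w).toPlane ∧ (w = e.parent ∨ w = e.child) ∧ (w = f.parent ∨ w = f.child))

/-- Every edge is strictly `y`-monotone, descending from the parent to the child. -/
def IsStrictlyUpward (D : PolylineDrawing T) : Prop :=
  ∀ e, (D.path e).Pairwise (fun p q => q.2 < p.2)

/-- The edges from a node to its children leave the node from left to right in the prescribed
order. All of them go downwards in a strictly-upward drawing, so "the edge that starts towards `a`
is left of the edge that starts towards `b`" means `dx_a / |dy_a| < dx_b / |dy_b|`, stated here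
without division. -/
def IsOrderPreserving (D : PolylineDrawing T) : Prop :=
  ∀ (u : V) (i j : Fin (T.children u).length), i < j →
    (((D.firstStep ⟨u, i⟩).1 : ℝ) - ((D.pos u).1 : ℝ)) * ((D.pos u).2 - (D.firstStep ⟨u, j⟩).2) <
    (((D.firstStep ⟨u, j⟩).1 : ℝ) - ((D.pos u).1 : ℝ)) * ((D.pos u).2 - (D.firstStep ⟨u, i⟩).2)

/-- No edge has a bend. -/
def IsStraightLine (D : PolylineDrawing T) : Prop :=
  ∀ e, D.bends e = []

/-- An ideal drawing is planar, strictly-upward, order-preserving and straight-line. -/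
def IsIdeal (D : PolylineDrawing T) : Prop :=
  D.IsPlanar ∧ D.IsStrictlyUpward ∧ D.IsOrderPreserving ∧ D.IsStraightLine

/-- The `x`-coordinates of all nodes and bends. -/
def columns (D : PolylineDrawing T) : Set ℤ :=
  {x | (∃ v, (D.pos v).1 = x) ∨ ∃ e, ∃ p ∈ D.bends e, p.1 = x}

/-- The smallest `W` such that, after a translation, all `x`-coordinates lie between `1` and
`W`. -/
noncomputable def width (D : PolylineDrawing T) : ℕ :=
  sInf {W : ℕ | ∃ t : ℤ, ∀ x ∈ D.columns, 1 ≤ x + t ∧ x + t ≤ (W : ℤ)}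

end PolylineDrawing

/-- The tree with root `u₁ = 0`, whose children are a leaf, a leaf, `u₂ = 3` and a leaf; the
children of `u₂` are a leaf, a leaf and `u₃ = 7`; the children of `u₃` are two leaves. -/
def treeA : OrderedTree (Fin 10) where
  root := 0
  children := ![[1, 2, 3, 4], [], [], [5, 6, 7], [], [], [], [8, 9], [], []]
  nodup_children := by decide
  root_not_child := by decide
  parent_unique := by decide
  reachable := by
    have h3 : Relation.ReflTransGen (fun u w : Fin 10 => w ∈ (![[1, 2, 3, 4], [], [], [5, 6, 7],
        [], [], [], [8, 9], [], []] : Fin 10 → List (Fin 10)) u) 0 3 := .single (by decide)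
    have h7 := h3.tail (c := 7) (by decide)
    intro v
    fin_cases v
    · exact .refl
    · exact .single (by decide)
    · exact .single (by decide)
    · exact h3
    · exact .single (by decide)
    · exact h3.tail (by decide)
    · exact h3.tail (by decide)
    · exact h7
    · exact h7.tail (by decide)
    · exact h7.tail (by decide)

/-- `treeA` with one further leaf, the node `10`, as the last child of `u₂`. -/
def treeB : OrderedTree (Fin 11) where
  root := 0
  children := ![[1, 2, 3, 4], [], [], [5, 6, 7, 10], [], [], [], [8, 9], [], [], []]
  nodup_children := by decide
  root_not_child := by decide
  parent_unique := by decide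
  reachable := by
    have h3 : Relation.ReflTransGen (fun u w : Fin 11 => w ∈ (![[1, 2, 3, 4], [], [], [5, 6, 7, 10],
        [], [], [], [8, 9], [], [], []] : Fin 11 → List (Fin 11)) u) 0 3 := .single (by decide)
    have h7 := h3.tail (c := 7) (by decide)
    intro v
    fin_cases v
    · exact .refl
    · exact .single (by decide)
    · exact .single (by decide)
    · exact h3
    · exact .single (by decide)
    · exact h3.tail (by decide)
    · exact h3.tail (by decide)
    · exact h7
    · exact h7.tail (by decide)
    · exact h7.tail (by decide)
    · exact h3.tail (by decide)

end TreeDrawing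

/-!
In a drawing of width `2` every node lies in the left or in the right column.

*No ideal drawing.* A node in the left column sends at most one straight edge down its own column,
and this edge is the leftmost one; so from the second child on all children lie in the right column,
and the order of the edges puts later children higher. If the third child `c` had two children, the
first of them would, by the mirrored argument, lie in the left column, and below its grandparent `a`.
The edge leading to it starts above the second child of `a` and ends below `a`, so it crosses the edge
from `a` to its second child: `IsIdeal.third_child_of_left`. Now `u₁` is not in the left column, since
its third child `u₂` has several children. So `u₁` is in the right column; `u₂` has a right sibling,
hence is in the left column, and its third child `u₃` has two children, a contradiction.

*Drawings with bends.* With `u₁` in the right column, the edge from `u₁` to `u₂` has to start towards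
the left column, but a bend there brings `u₂` back to the right column, and `u₃` can be placed in the
left one. No other bend is needed. The drawing of `treeB` is explicit (`nodePos`, `nodeBends`), and
since its vertices are integral, planarity amounts to linear conditions for each pair of edges
(`common_end_of_onEdge`). `treeA` inherits the drawing by restriction (`IsEmbedding.exists_drawing`).
-/

namespace TreeDrawing

open PolylineDrawing

/-! ### Strictly descending poly-lines -/

/-- A point of a descending segment lies between the heights of its ends, on the line through them;
it is an end if it has the height of that end. -/
lemma mem_segment_descending {P Q p : ℝ × ℝ} (hPQ : Q.2 < P.2) (hp : p ∈ segment ℝ P Q) :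
    Q.2 ≤ p.2 ∧ p.2 ≤ P.2 ∧ (p.1 - P.1) * (Q.2 - P.2) = (p.2 - P.2) * (Q.1 - P.1) ∧
      (p.2 = P.2 → p = P) ∧ (p.2 = Q.2 → p = Q) := by
  obtain ⟨a, b, ha, hb, hab, rfl⟩ := hp
  obtain rfl : a = 1 - b := by linarith
  simp only [Prod.snd_add, Prod.smul_snd, Prod.fst_add, Prod.smul_fst, smul_eq_mul]
  refine ⟨by nlinarith, by nlinarith, by ring, fun h => ?_, fun h => ?_⟩
  · have hb0 : b * (Q.2 - P.2) = 0 := by linarith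
    obtain rfl : b = 0 := (mul_eq_zero.1 hb0).resolve_right (by linarith)
    simp
  · have hb0 : (1 - b) * (P.2 - Q.2) = 0 := by linarith
    obtain hb1 : 1 - b = 0 := (mul_eq_zero.1 hb0).resolve_right (by linarith)
    obtain rfl : b = 1 := by linarith
    simp

lemma le_of_mem_trace_cons {p : GridPoint} {b : List GridPoint}
    (h : (p :: b).Pairwise fun p q => q.2 < p.2) {q : ℝ × ℝ} (hq : q ∈ trace (p :: b)) :
    q.2 ≤ p.2 ∧ (q.2 = p.2 → q = p.toPlane) := by
  induction b generalizing p with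
  | nil =>
    obtain rfl : q = p.toPlane := hq
    exact ⟨le_rfl, fun _ => rfl⟩
  | cons r b ih =>
    have hr : r.2 < p.2 := List.rel_of_pairwise_cons h (by simp)
    rcases hq with hq | hq
    · obtain ⟨-, h1, -, h2, -⟩ := mem_segment_descending (P := p.toPlane) (Q := r.toPlane) hr hq
      exact ⟨h1, h2⟩
    · have := (ih h.of_cons hq).1
      exact ⟨by linarith, fun h => by linarith⟩

lemma le_of_mem_trace_append {p : GridPoint} {a : List GridPoint}
    (h : (a ++ [p]).Pairwise fun p q => q.2 < p.2) {q : ℝ × ℝ} (hq : q ∈ trace (a ++ [p])) :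
    p.2 ≤ q.2 ∧ (q.2 = p.2 → q = p.toPlane) := by
  induction a with
  | nil =>
    obtain rfl : q = p.toPlane := hq
    exact ⟨le_rfl, fun _ => rfl⟩
  | cons s a ih =>
    cases a with
    | nil =>
      have hs : p.2 < s.2 := List.rel_of_pairwise_cons h (by simp)
      have hq' : q ∈ segment ℝ s.toPlane p.toPlane := by
        rcases hq with hq | hq
        · exact hq
        · obtain rfl : q = p.toPlane := hq
          exact right_mem_segment ℝ _ _
      obtain ⟨h1, -, -, -, h2⟩ := mem_segment_descending (P := s.toPlane) (Q := p.toPlane) hs hq'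
      exact ⟨h1, h2⟩
    | cons t a =>
      have hs : t.2 < s.2 := List.rel_of_pairwise_cons h (by simp)
      have ht : p.2 < t.2 := List.rel_of_pairwise_cons (List.Pairwise.of_cons h) (by simp)
      rcases hq with hq | hq
      · obtain ⟨h1, -⟩ := mem_segment_descending (P := s.toPlane) (Q := t.toPlane) hs hq
        replace h1 : t.2 ≤ q.2 := h1
        exact ⟨by linarith, fun h => by linarith⟩
      · exact ih (List.Pairwise.of_cons h) hq

lemma isSimplePolyline_of_descending {l : List GridPoint}
    (h : l.Pairwise fun p q => q.2 < p.2) : IsSimplePolyline l := by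
  refine ⟨h.imp fun {p q} hpq hne => by simp [hne] at hpq, ?_⟩
  rintro a b p rfl q ⟨hq1, hq2⟩
  have h1 : (a ++ [p]).Pairwise fun p q : GridPoint => q.2 < p.2 :=
    h.sublist (by simp)
  have h2 : (p :: b).Pairwise fun p q : GridPoint => q.2 < p.2 :=
    h.sublist (by simp)
  have h3 := le_of_mem_trace_append h1 hq1
  have h4 := le_of_mem_trace_cons h2 hq2
  exact h3.2 (le_antisymm h4.1 h3.1)

/-! ### Ideal drawings in two columns -/

/-- Two segments that join two vertical lines and have their ends in opposite order on them
intersect. -/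
lemma exists_mem_segment_inter {x x' y₁ y₁' y₂ y₂' : ℝ} (h : y₂ < y₁) (h' : y₁' < y₂') :
    ∃ p, p ∈ segment ℝ (x, y₁) (x', y₁') ∧ p ∈ segment ℝ (x', y₂') (x, y₂) := by
  have hd : 0 < (y₁ - y₂) + (y₂' - y₁') := by linarith
  set t := (y₁ - y₂) / ((y₁ - y₂) + (y₂' - y₁')) with ht
  have ht0 : 0 ≤ t := div_nonneg (by linarith) hd.le
  have ht1 : t ≤ 1 := (div_le_one hd).2 (by linarith)
  have key : t * ((y₁ - y₂) + (y₂' - y₁')) = y₁ - y₂ := div_mul_cancel₀ _ hd.ne'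
  refine ⟨((1 - t) * x + t * x', (1 - t) * y₁ + t * y₁'),
    ⟨1 - t, t, by linarith, ht0, by ring, by simp⟩,
    ⟨t, 1 - t, ht0, by linarith, by ring, ?_⟩⟩
  ext
  · simp only [Prod.smul_mk, Prod.mk_add_mk, smul_eq_mul]
    ring
  · simp only [Prod.smul_mk, Prod.mk_add_mk, smul_eq_mul]
    linear_combination key

namespace PolylineDrawing

variable {V : Type} {T : OrderedTree V} {D : PolylineDrawing T}

lemma IsStrictlyUpward.child_lt (hD : D.IsStrictlyUpward) (e : T.Edge) :
    (D.pos e.child).2 < (D.pos e.parent).2 :=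
  List.rel_of_pairwise_cons (hD e) (by simp)

lemma IsStraightLine.trace_path (hD : D.IsStraightLine) (e : T.Edge) :
    segment ℝ (D.pos e.parent).toPlane (D.pos e.child).toPlane ⊆ trace (D.path e) := by
  rw [path, hD e]
  exact Set.subset_union_left

lemma IsIdeal.order (hD : D.IsIdeal) {u : V} {i j : Fin (T.children u).length} (hij : i < j) :
    (((D.pos ((T.children u).get i)).1 : ℝ) - (D.pos u).1) *
        ((D.pos u).2 - (D.pos ((T.children u).get j)).2) <
      (((D.pos ((T.children u).get j)).1 : ℝ) - (D.pos u).1) *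
        ((D.pos u).2 - (D.pos ((T.children u).get i)).2) := by
  have h := hD.2.2.1 u i j hij
  simp only [firstStep] at h
  rw [hD.2.2.2, hD.2.2.2] at h
  exact h

/-- All children of a node in the left column but the first lie in the right column. -/
lemma IsIdeal.child_right (hD : D.IsIdeal) {m : ℤ}
    (hm : ∀ v, (D.pos v).1 = m ∨ (D.pos v).1 = m + 1) {u : V} (hu : (D.pos u).1 = m)
    {i j : Fin (T.children u).length} (hij : i < j) :
    (D.pos ((T.children u).get j)).1 = m + 1 := by
  refine (hm _).resolve_left fun hj => ?_
  have h := hD.order hij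
  have hy : (D.pos ((T.children u).get j)).2 < (D.pos u).2 := hD.2.1.child_lt ⟨u, j⟩
  rw [hj, hu] at h
  rcases hm ((T.children u).get i) with hi | hi <;> rw [hi] at h <;> push_cast at h <;> linarith

/-- All children of a node in the right column but the last lie in the left column. -/
lemma IsIdeal.child_left (hD : D.IsIdeal) {m : ℤ}
    (hm : ∀ v, (D.pos v).1 = m ∨ (D.pos v).1 = m + 1) {u : V} (hu : (D.pos u).1 = m + 1)
    {i j : Fin (T.children u).length} (hij : i < j) :
    (D.pos ((T.children u).get i)).1 = m := by
  refine (hm _).resolve_right fun hi => ?_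
  have h := hD.order hij
  have hy : (D.pos ((T.children u).get i)).2 < (D.pos u).2 := hD.2.1.child_lt ⟨u, i⟩
  rw [hi, hu] at h
  rcases hm ((T.children u).get j) with hj | hj <;> rw [hj] at h <;> push_cast at h <;> linarith

/-- The third child of a node in the left column has at most one child: otherwise the edge to its
first child would cross the edge from the node to its second child. -/
lemma IsIdeal.third_child_of_left (hD : D.IsIdeal) {m : ℤ}
    (hm : ∀ v, (D.pos v).1 = m ∨ (D.pos v).1 = m + 1) {a : V} (ha : (D.pos a).1 = m)
    (h3 : 2 < (T.children a).length) : (T.children (T.children a)[2]).length ≤ 1 := by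
  by_contra! h2
  let e : T.Edge := ⟨a, ⟨1, by omega⟩⟩
  let g : T.Edge := ⟨a, ⟨2, h3⟩⟩
  let f : T.Edge := ⟨g.child, ⟨0, by change 0 < (T.children (T.children a)[2]).length; omega⟩⟩
  have hb : (D.pos e.child).1 = m + 1 :=
    hD.child_right hm ha (i := ⟨0, by omega⟩) (j := ⟨1, by omega⟩) (by simp)
  have hc : (D.pos g.child).1 = m + 1 :=
    hD.child_right hm ha (i := ⟨0, by omega⟩) (j := ⟨2, h3⟩) (by simp)
  have hx : (D.pos f.child).1 = m :=
    hD.child_left hm hc (i := ⟨0, _⟩) (j := ⟨1, h2⟩) Nat.zero_lt_one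
  have hca : (D.pos g.child).2 < (D.pos a).2 := hD.2.1.child_lt g
  have hxc : (D.pos f.child).2 < (D.pos g.child).2 := hD.2.1.child_lt f
  have hbc : (D.pos e.child).2 < (D.pos g.child).2 := by
    have h := hD.order (u := a) (i := ⟨1, by omega⟩) (j := ⟨2, h3⟩) (by simp)
    change (((D.pos e.child).1 : ℝ) - _) * (_ - (D.pos g.child).2) <
      (((D.pos g.child).1 : ℝ) - _) * (_ - (D.pos e.child).2) at h
    rw [hb, hc, ha] at h
    push_cast at h
    linarith
  obtain ⟨p, hpe, hpf⟩ := exists_mem_segment_inter (x := (m : ℝ)) (x' := ((m + 1 : ℤ) : ℝ))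
    (hxc.trans hca) hbc
  have hpe' : p ∈ trace (D.path e) := hD.2.2.2.trace_path e (by
    have h1 : (D.pos e.parent).toPlane = ((m : ℝ), (D.pos a).2) := by
      rw [← ha]; rfl
    have h2 : (D.pos e.child).toPlane = (((m + 1 : ℤ) : ℝ), (D.pos e.child).2) := by
      rw [← hb]; rfl
    rwa [h1, h2])
  have hpf' : p ∈ trace (D.path f) := hD.2.2.2.trace_path f (by
    have h1 : (D.pos f.parent).toPlane = (((m + 1 : ℤ) : ℝ), (D.pos g.child).2) := by
      rw [← hc]; rfl
    have h2 : (D.pos f.child).toPlane = ((m : ℝ), (D.pos f.child).2) := by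
      rw [← hx]; rfl
    rwa [h1, h2])
  -- The two edges have no common end, so their common point contradicts planarity.
  have hac : a ≠ g.child := fun h => by rw [← h] at hca; exact lt_irrefl _ hca
  have hax : a ≠ f.child := fun h => by rw [← h] at hxc; exact lt_asymm hxc hca
  have hbc' : e.child ≠ g.child := fun h => by rw [h] at hbc; exact lt_irrefl _ hbc
  have hbx : e.child ≠ f.child := fun h => hac <|
    T.parent_unique a g.child e.child (List.get_mem _ _) (by rw [h]; exact List.get_mem _ _)
  have hef : e ≠ f := fun h => hbx (by rw [← h])
  obtain ⟨w, -, rfl | rfl, h | h⟩ := hD.1.2.2.2 e f hef p ⟨hpe', hpf'⟩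
  · exact hac h
  · exact hax h
  · exact hbc' h
  · exact hbx h

/-- The attained minimum in the definition of width, with the translation moved to the columns. -/
lemma exists_columns_of_width_eq_two (hW : D.width = 2) :
    ∃ m : ℤ, ∀ v, (D.pos v).1 = m ∨ (D.pos v).1 = m + 1 := by
  -- `sInf ∅ = 0`, so the set of admissible widths is not empty.
  have hne : {W : ℕ | ∃ t : ℤ, ∀ x ∈ D.columns, 1 ≤ x + t ∧ x + t ≤ (W : ℤ)}.Nonempty := by
    by_contra h
    rw [Set.not_nonempty_iff_eq_empty] at h
    simp [width, h] at hW
  obtain ⟨t, ht⟩ := Nat.sInf_mem hne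
  change ∀ x ∈ D.columns, 1 ≤ x + t ∧ x + t ≤ (D.width : ℤ) at ht
  rw [hW] at ht
  refine ⟨1 - t, fun v => ?_⟩
  have := ht _ (Or.inl ⟨v, rfl⟩)
  push_cast at this
  omega

/-- A tree has no ideal drawing of width two if some node has four children, the third of these has
three children, and the third of those has two children. -/
theorem not_ideal_of_third_children (u : V) (h4 : 3 < (T.children u).length)
    (h3 : 2 < (T.children (T.children u)[2]).length)
    (h2 : 1 < (T.children (T.children (T.children u)[2])[2]).length) :
    ¬ ∃ D : PolylineDrawing T, D.IsIdeal ∧ D.width = 2 := by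
  rintro ⟨D, hD, hW⟩
  obtain ⟨m, hm⟩ := exists_columns_of_width_eq_two hW
  rcases hm u with hu | hu
  · have := hD.third_child_of_left hm hu (by omega)
    omega
  · have hv := hD.child_left hm hu (i := ⟨2, by omega⟩) (j := ⟨3, h4⟩) (by simp)
    have := hD.third_child_of_left hm hv h3
    exact absurd h2 (by simpa using this)

end PolylineDrawing

/-! ### A drawing with one bend -/

/-- An integral point as a point of the grid. -/
def gridOfInt (p : ℤ × ℤ) : GridPoint := (p.1, (p.2 : ℝ))

/-- The positions of the nodes of `treeB`. -/
def nodePos : Fin 11 → ℤ × ℤ :=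
  ![(1, 10), (0, 9), (0, 8), (1, 6), (1, 8), (0, 5), (0, 4), (0, 3), (0, 2), (1, 2), (1, 5)]

/-- The parents of the nodes of `treeB`; the value at the root is arbitrary. -/
def nodeParent : Fin 11 → Fin 11 := ![0, 0, 0, 0, 0, 3, 3, 3, 7, 7, 3]

/-- The bends on the edge that leads to a node of `treeB`. The only bend, on the edge from `u₁` to
`u₂`, lies in the left column, below the first two children of `u₁`. -/
def nodeBends : Fin 11 → List (ℤ × ℤ) := fun c => if c = 3 then [(0, 7)] else []

/-- The vertices of the edge that leads to a node of `treeB`. -/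
def nodePath (c : Fin 11) : List (ℤ × ℤ) :=
  nodePos (nodeParent c) :: (nodeBends c ++ [nodePos c])

/-- The drawing of a tree induced from that of `treeB` by a map of its nodes to those of `treeB`. -/
def inducedDrawing {V : Type} (T : OrderedTree V) (ι : V → Fin 11) : PolylineDrawing T where
  pos v := gridOfInt (nodePos (ι v))
  bends e := (nodeBends (ι e.child)).map gridOfInt

lemma gridOfInt_injective : Function.Injective gridOfInt := by
  rintro ⟨a, b⟩ ⟨c, d⟩ h
  simpa [gridOfInt] using h

lemma nodePath_descending : ∀ c, c ≠ 0 → (nodePath c).Pairwise fun p q => q.2 < p.2 := by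
  decide

/-- The linear conditions that a point of a segment between two integral points satisfies. -/
lemma mem_segment_gridOfInt {P Q : ℤ × ℤ} {p : ℝ × ℝ} (hPQ : Q.2 < P.2)
    (hp : p ∈ segment ℝ (gridOfInt P).toPlane (gridOfInt Q).toPlane) :
    (Q.2 : ℝ) ≤ p.2 ∧ p.2 ≤ P.2 ∧
      (p.1 - P.1) * ((Q.2 : ℝ) - P.2) = (p.2 - P.2) * ((Q.1 : ℝ) - P.1) := by
  obtain ⟨h1, h2, h3, -⟩ := mem_segment_descending
    (P := (gridOfInt P).toPlane) (Q := (gridOfInt Q).toPlane)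
    (by simpa [gridOfInt, GridPoint.toPlane] using hPQ) hp
  exact ⟨h1, h2, h3⟩

/-- The linear conditions on the points of the edge that leads to the node `c` of `treeB`; the edge
to `u₂ = 3` is the one with two segments. -/
def OnEdge (c : Fin 11) (x y : ℝ) : Prop :=
  if c = 3 then (6 ≤ y ∧ y ≤ 7 ∧ y = 7 - x) ∨ (7 ≤ y ∧ y ≤ 10 ∧ y = 7 + 3 * x)
  else ((nodePos c).2 : ℝ) ≤ y ∧ y ≤ (nodePos (nodeParent c)).2 ∧
    (x - (nodePos (nodeParent c)).1) * (((nodePos c).2 : ℝ) - (nodePos (nodeParent c)).2) =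
      (y - (nodePos (nodeParent c)).2) * (((nodePos c).1 : ℝ) - (nodePos (nodeParent c)).1)

lemma onEdge_of_mem_trace {c : Fin 11} (hc : c ≠ 0) {p : ℝ × ℝ}
    (hp : p ∈ trace ((nodePath c).map gridOfInt)) : OnEdge c p.1 p.2 := by
  by_cases h3 : c = 3
  · subst h3
    simp only [OnEdge, if_true]
    rcases hp with hp | hp | hp
    · obtain ⟨h1, h2, h3⟩ := mem_segment_gridOfInt (by decide) hp
      simp [nodePos, nodeParent] at h1 h2 h3
      exact Or.inr ⟨h1, h2, by linarith⟩
    · obtain ⟨h1, h2, h3⟩ := mem_segment_gridOfInt (by decide) hp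
      simp [nodePos] at h1 h2 h3
      exact Or.inl ⟨h1, h2, by linarith⟩
    · obtain rfl : p = (gridOfInt (nodePos 3)).toPlane := hp
      simp [nodePos, gridOfInt, GridPoint.toPlane]
      norm_num
  · have hd : (nodePos c).2 < (nodePos (nodeParent c)).2 :=
      List.rel_of_pairwise_cons (nodePath_descending c hc) (by simp)
    simp only [nodePath, nodeBends, if_neg h3, List.nil_append, List.map_cons, List.map_nil] at hp
    simp only [OnEdge, if_neg h3]
    rcases hp with hp | hp
    · exact mem_segment_gridOfInt hd hp
    · obtain rfl : p = (gridOfInt (nodePos c)).toPlane := hp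
      exact mem_segment_gridOfInt hd (right_mem_segment ℝ _ _)

/-- An edge contains no node but its ends. -/
lemma eq_end_of_onEdge {c w : Fin 11} (hc : c ≠ 0)
    (h : OnEdge c ((nodePos w).1 : ℝ) ((nodePos w).2 : ℝ)) : w = nodeParent c ∨ w = c := by
  fin_cases c <;> first | exact absurd rfl hc | skip
  all_goals
    fin_cases w <;>
      first
      | exact Or.inl rfl
      | exact Or.inr rfl
      | (exfalso; simp [OnEdge, nodePos, nodeParent] at h <;> norm_num at h)

/-- Two edges meet only in a common end. For each pair of edges the linear conditions are either
contradictory or have a common end as their only solution. -/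
lemma common_end_of_onEdge {c d : Fin 11} (hc : c ≠ 0) (hd : d ≠ 0) (hcd : c < d) {x y : ℝ}
    (h1 : OnEdge c x y) (h2 : OnEdge d x y) :
    ∃ w, (x = (nodePos w).1 ∧ y = (nodePos w).2) ∧
      (w = nodeParent c ∨ w = c) ∧ (w = nodeParent d ∨ w = d) := by
  fin_cases c <;> first | exact absurd rfl hc | skip
  all_goals
    simp [OnEdge, nodePos, nodeParent] at h1
    fin_cases d <;> first | exact absurd rfl hd | exact absurd hcd (by decide) | skip
  all_goals simp [OnEdge, nodePos, nodeParent] at h2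
  all_goals
    first
    | (exfalso; grind)
    | (refine ⟨0, ?_, by decide, by decide⟩; simp [nodePos]; grind)
    | (refine ⟨3, ?_, by decide, by decide⟩; simp [nodePos]; grind)
    | (refine ⟨7, ?_, by decide, by decide⟩; simp [nodePos]; grind)

/-- A map of the nodes of `T` to the nodes of `treeB` that respects the edges and their order. -/
structure IsEmbedding {V : Type} (T : OrderedTree V) (ι : V → Fin 11) : Prop where
  injective : Function.Injective ι
  parent : ∀ e : T.Edge, ι e.parent = nodeParent (ι e.child)
  child_ne : ∀ e : T.Edge, ι e.child ≠ 0
  lt : ∀ (u : V) (i j : Fin (T.children u).length), i < j →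
    ι ((T.children u).get i) < ι ((T.children u).get j)

/-- The vertex that follows the parent on the edge leading to a node of `treeB`. -/
def nodeFirstStep (c : Fin 11) : ℤ × ℤ := (nodeBends c).headD (nodePos c)

/-- Among the edges from one node, those to children with larger numbers leave further right. -/
lemma nodeFirstStep_order : ∀ c d : Fin 11, c ≠ 0 → d ≠ 0 → c < d → nodeParent c = nodeParent d →
    ((nodeFirstStep c).1 - (nodePos (nodeParent c)).1) *
        ((nodePos (nodeParent c)).2 - (nodeFirstStep d).2) <
      ((nodeFirstStep d).1 - (nodePos (nodeParent c)).1) *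
        ((nodePos (nodeParent c)).2 - (nodeFirstStep c).2) := by
  decide

lemma gridOfInt_eq_iff {p : ℝ × ℝ} {q : ℤ × ℤ} :
    p = (gridOfInt q).toPlane ↔ p.1 = q.1 ∧ p.2 = q.2 :=
  Prod.ext_iff

namespace IsEmbedding

variable {V : Type} {T : OrderedTree V} {ι : V → Fin 11}

lemma path (h : IsEmbedding T ι) (e : T.Edge) :
    (inducedDrawing T ι).path e = (nodePath (ι e.child)).map gridOfInt := by
  simp [PolylineDrawing.path, nodePath, inducedDrawing, h.parent e]

lemma child_injective (h : IsEmbedding T ι) {e f : T.Edge} (hef : ι e.child = ι f.child) :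
    e = f := by
  obtain ⟨u, i⟩ := e
  obtain ⟨v, j⟩ := f
  have hc : (T.children u).get i = (T.children v).get j := h.injective hef
  obtain rfl : u = v :=
    T.parent_unique u v _ (List.get_mem _ i) (by rw [hc]; exact List.get_mem _ j)
  obtain rfl : i = j := (T.nodup_children u).injective_get hc
  rfl

lemma isStrictlyUpward (h : IsEmbedding T ι) : (inducedDrawing T ι).IsStrictlyUpward := by
  intro e
  rw [h.path e, List.pairwise_map]
  exact (nodePath_descending _ (h.child_ne e)).imp fun hpq => by simpa [gridOfInt] using hpq

lemma isOrderPreserving (h : IsEmbedding T ι) : (inducedDrawing T ι).IsOrderPreserving := by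
  intro u i j hij
  have hi : ι u = nodeParent (ι ((T.children u).get i)) := h.parent ⟨u, i⟩
  have hj : ι u = nodeParent (ι ((T.children u).get j)) := h.parent ⟨u, j⟩
  have hs (k : Fin (T.children u).length) : (inducedDrawing T ι).firstStep ⟨u, k⟩ =
      gridOfInt (nodeFirstStep (ι ((T.children u).get k))) :=
    List.headD_map.trans rfl
  have key := nodeFirstStep_order (ι ((T.children u).get i)) (ι ((T.children u).get j))
    (h.child_ne ⟨u, i⟩) (h.child_ne ⟨u, j⟩) (h.lt u i j hij) (hi.symm.trans hj)
  rw [← hi] at key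
  rw [hs, hs]
  simp only [inducedDrawing, gridOfInt]
  exact_mod_cast key

lemma isPlanar (h : IsEmbedding T ι) : (inducedDrawing T ι).IsPlanar := by
  have hon (e : T.Edge) {p : ℝ × ℝ} (hp : p ∈ trace ((inducedDrawing T ι).path e)) :
      OnEdge (ι e.child) p.1 p.2 :=
    onEdge_of_mem_trace (h.child_ne e) (h.path e ▸ hp)
  refine ⟨?_, fun e => isSimplePolyline_of_descending (h.isStrictlyUpward e), ?_, ?_⟩
  · exact gridOfInt_injective.comp
      ((by decide : Function.Injective nodePos).comp h.injective)
  · intro e w hw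
    rcases eq_end_of_onEdge (w := ι w) (h.child_ne e) (hon e hw) with hw | hw
    · exact Or.inl (h.injective (hw.trans (h.parent e).symm))
    · exact Or.inr (h.injective hw)
  · rintro e f hef p ⟨hpe, hpf⟩
    -- The statement for `treeB` yields a common end there, which is an end of `e` in `T`.
    suffices H : ∃ w, (p.1 = (nodePos w).1 ∧ p.2 = (nodePos w).2) ∧
        (w = nodeParent (ι e.child) ∨ w = ι e.child) ∧
        (w = nodeParent (ι f.child) ∨ w = ι f.child) by
      obtain ⟨w, hp, hwe, hwf⟩ := H
      rw [← h.parent] at hwe hwf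
      obtain ⟨v, rfl⟩ : ∃ v, w = ι v := by rcases hwe with hw | hw <;> exact ⟨_, hw⟩
      exact ⟨v, gridOfInt_eq_iff.2 hp, hwe.imp (h.injective ·) (h.injective ·),
        hwf.imp (h.injective ·) (h.injective ·)⟩
    rcases lt_or_gt_of_ne fun hc => hef (h.child_injective hc) with hlt | hlt
    · exact common_end_of_onEdge (h.child_ne e) (h.child_ne f) hlt (hon e hpe) (hon f hpf)
    · obtain ⟨w, hp, hwf, hwe⟩ :=
        common_end_of_onEdge (h.child_ne f) (h.child_ne e) hlt (hon f hpf) (hon e hpe)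
      exact ⟨w, hp, hwe, hwf⟩

lemma width_eq_two {v w : V} (hv : ι v = 0) (hw : ι w = 1) : (inducedDrawing T ι).width = 2 := by
  have hcol : ∀ x ∈ (inducedDrawing T ι).columns, x = 0 ∨ x = 1 := by
    rintro x (⟨v, rfl⟩ | ⟨e, p, hp, rfl⟩)
    · exact (by decide : ∀ c, (nodePos c).1 = 0 ∨ (nodePos c).1 = 1) (ι v)
    · obtain ⟨q, hq, rfl⟩ := List.mem_map.1 hp
      exact (by decide : ∀ c, ∀ q ∈ nodeBends c, q.1 = 0 ∨ q.1 = 1) (ι e.child) q hq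
  have h1 : (1 : ℤ) ∈ (inducedDrawing T ι).columns :=
    Or.inl ⟨v, by simp [inducedDrawing, hv, gridOfInt, nodePos]⟩
  have h0 : (0 : ℤ) ∈ (inducedDrawing T ι).columns :=
    Or.inl ⟨w, by simp [inducedDrawing, hw, gridOfInt, nodePos]⟩
  refine IsLeast.csInf_eq ⟨⟨1, fun x hx => ?_⟩, fun W ⟨t, ht⟩ => ?_⟩
  · rcases hcol x hx with rfl | rfl <;> norm_num
  · have := ht 0 h0
    have := ht 1 h1
    omega

lemma exists_drawing (h : IsEmbedding T ι) {v w : V} (hv : ι v = 0) (hw : ι w = 1) :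
    ∃ D : PolylineDrawing T,
      D.IsPlanar ∧ D.IsStrictlyUpward ∧ D.IsOrderPreserving ∧ D.width = 2 :=
  ⟨inducedDrawing T ι, h.isPlanar, h.isStrictlyUpward, h.isOrderPreserving, width_eq_two hv hw⟩

end IsEmbedding

lemma isEmbedding_treeA : IsEmbedding treeA Fin.castSucc where
  injective := Fin.castSucc_injective _
  parent := by decide
  child_ne := by decide
  lt := by decide

lemma isEmbedding_treeB : IsEmbedding treeB id where
  injective := Function.injective_id
  parent := by decide
  child_ne := by decide
  lt := by decide

end TreeDrawing

theorem mainTheorem4 :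
    ((∀ u, (TreeDrawing.treeA.children u).length ≤ 4) ∧
      (∃ D : TreeDrawing.PolylineDrawing TreeDrawing.treeA,
        D.IsPlanar ∧ D.IsStrictlyUpward ∧ D.IsOrderPreserving ∧ D.width = 2) ∧
      ¬ ∃ D : TreeDrawing.PolylineDrawing TreeDrawing.treeA, D.IsIdeal ∧ D.width = 2) ∧
    ((∀ u, (TreeDrawing.treeB.children u).length ≤ 4) ∧
      (∃ D : TreeDrawing.PolylineDrawing TreeDrawing.treeB,
        D.IsPlanar ∧ D.IsStrictlyUpward ∧ D.IsOrderPreserving ∧ D.width = 2) ∧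
      ¬ ∃ D : TreeDrawing.PolylineDrawing TreeDrawing.treeB, D.IsIdeal ∧ D.width = 2) := by
  refine ⟨⟨by decide, ?_, ?_⟩, ⟨by decide, ?_, ?_⟩⟩
  · exact TreeDrawing.isEmbedding_treeA.exists_drawing (v := 0) (w := 1) rfl rfl
  · exact TreeDrawing.PolylineDrawing.not_ideal_of_third_children 0
      (by decide) (by decide) (by decide)
  · exact TreeDrawing.isEmbedding_treeB.exists_drawing (v := 0) (w := 1) rfl rfl
  · exact TreeDrawing.PolylineDrawing.not_ideal_of_third_children 0
      (by decide) (by decide) (by decide)
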